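/- Let $A$ be a finite alphabet and let $\sigma : A \to A^+$ be a substitution, that is, an arbitrary map (not necessarily primitive) from $A$ to the set $A^+$ of nonempty words over $A$, extended to words by concatenation. Let $L(\sigma)$ be the set of all factors of the words $\sigma^n(a)$, $a\in A$, $n\ge 1$. Let $$X_\sigma=\{x\in A^{\mathbb Z} : x[-n,n]\in L(\sigma)\text{ for all } n\ge 0\},$$ where $x[-n,n]=x[-n]\cdots x[n]$, and let $T$ be the left shift, $(Tx)[k]=x[k+1]$. For $y\in A^{\mathbb Z}$ let $\sigma(y)=\cdots\sigma(y[-1])\,.\,\sigma(y[0])\,\sigma(y[1])\cdots$, where the first letter of $\sigma(y[0])$ is at position $0$. Suppose that $\sigma$ is aperiodic, i.e. that $X_\sigma$ contains no $T$-periodic point. Then $\sigma$ is recognizable: for every $x\in X_\sigma$ there is exactly one pair $(y,i)$ with $y\in X_\sigma$ and $0\le i<|\sigma(y[0])|$ such that $x=T^i\sigma(y)$. -/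

import Mathlib

/-- A substitution on the alphabet `A`: a map assigning to every letter a nonempty word. -/
structure Substitution (A : Type*) where
  /-- The word `σ(a)`. -/
  word : A → List A
  word_ne_nil : ∀ a, word a ≠ []

namespace Substitution

variable {A : Type*} (σ : Substitution A)

/-- The extension of `σ` to words by concatenation, `σ(w₀ … wₖ) = σ(w₀) … σ(wₖ)`. -/
def onWord (w : List A) : List A :=
  w.flatMap σ.word

/-- The language `L(σ)`: all factors of the words `σⁿ(a)`, `a ∈ A`, `n ≥ 1`. -/
def language : Set (List A) :=
  {w | ∃ (a : A) (n : ℕ), 1 ≤ n ∧ w <:+: σ.onWord^[n] [a]}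

/-- The word `x[i, j] = x(i) x(i+1) … x(j)` of a bi-infinite sequence `x` (empty if `j < i`). -/
def factor (x : ℤ → A) (i j : ℤ) : List A :=
  (List.range (j + 1 - i).toNat).map fun t : ℕ => x (i + t)

/-- The subshift `X_σ`: all bi-infinite sequences `x` with `x[-n, n] ∈ L(σ)` for every `n`. -/
def subshift : Set (ℤ → A) :=
  {x | ∀ n : ℕ, factor x (-n) n ∈ σ.language}

/-- The left shift `T` on bi-infinite sequences, `(T x)(k) = x(1 + k)`. -/
abbrev leftShift : (ℤ → A) → (ℤ → A) :=
  SymbolicDynamics.FullShift.shift (1 : ℤ)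

/-- `σ` is aperiodic if the system `(X_σ, T)` has no periodic points. -/
def IsAperiodic : Prop :=
  ∀ x ∈ σ.subshift, x ∉ Function.periodicPts (leftShift (A := A))

/-- A concatenation of `n + 1` nonempty words has more than `n` letters. -/
theorem lt_length_flatMap_range (f : ℕ → List A) (hf : ∀ i, f i ≠ []) (n : ℕ) :
    n < ((List.range (n + 1)).flatMap f).length := by
  have h : ∀ m, m ≤ ((List.range m).flatMap f).length := by
    intro m
    induction m with
    | zero => exact Nat.zero_le _
    | succ m ih =>
      have := List.length_pos_of_ne_nil (hf m)
      simp only [List.range_succ, List.flatMap_append, List.flatMap_singleton, List.length_append]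
      omega
  exact h (n + 1)

/-- The action of `σ` on bi-infinite sequences:
`σ(y) = … σ(y(-2)) σ(y(-1)) . σ(y(0)) σ(y(1)) …`, the first letter of `σ(y(0))` being at
position `0`. The letter at a position `n ≥ 0` is the letter number `n` of the word
`σ(y(0)) σ(y(1)) … σ(y(n))`. The letter at a position `-(n+1) < 0` is the letter number `n`,
counted from the right end and starting with `0`, of the word `σ(y(-n-1)) … σ(y(-2)) σ(y(-1))`,
that is, the letter number `n` of the concatenation of the reversed words of
`σ(y(-1)), σ(y(-2)), …, σ(y(-n-1))`. -/
def onSeq (y : ℤ → A) : ℤ → A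
  | Int.ofNat n =>
      ((List.range (n + 1)).flatMap fun i : ℕ => σ.word (y (i : ℤ)))[n]'
        (lt_length_flatMap_range _ (fun _ => σ.word_ne_nil _) n)
  | Int.negSucc n =>
      ((List.range (n + 1)).flatMap fun i : ℕ => (σ.word (y (-(i : ℤ) - 1))).reverse)[n]'
        (lt_length_flatMap_range _
          (fun _ => mt List.reverse_eq_nil_iff.mp (σ.word_ne_nil _)) n)

/-- `σ` is recognizable if every `x ∈ X_σ` can be written as `x = Tⁱ σ(y)` for exactly one pair
`(y, i)` with `y ∈ X_σ` and `0 ≤ i < |σ(y(0))|`. -/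
def IsRecognizable : Prop :=
  ∀ x ∈ σ.subshift, ∃! p : (ℤ → A) × ℕ,
    p.1 ∈ σ.subshift ∧ p.2 < (σ.word (p.1 0)).length ∧ x = leftShift^[p.2] (σ.onSeq p.1)

end Substitution

/-! Existence is compactness: long factors of `x` lie in words `σ(v)` with `v ∈ L(σ)`, and an
ultrafilter limit of the finite desubstitutions gives `y`.

Uniqueness rests on elementary morphisms, those that do not factor through a smaller alphabet. The
defect theorem (`exists_factorsThrough_card_quot`) says that each coincidence between parsings of
one-sided streams saves a letter. So an elementary `τ` has no coincidence: the first letter of a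
parsing is determined by the stream (`eq_of_startRel`), and a cut inside a word `τ a` determines by
its place alone which letter follows (`eq_of_suffix`). Hence two parsings of a bi-infinite sequence
agree to the right of a common cut, and as long as they have none, the pair of parsing states
evolves deterministically in a finite set. Two different parsings therefore force periodicity
(`periodic_of_ne`).

The map `σ` itself need not be elementary. Among all factorizations `σⁿ = α ∘ β` take one with the
smallest middle alphabet; then `σ ∘ α` is elementary (`exists_isElementary`). Points of `X_σ` are
concatenations of words `α c`, so any two representations of `x` refine to parsings by `σ ∘ α`. By
aperiodicity these coincide, and they determine `y` and `i`. -/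

namespace Substitution

/-! ### One-sided parsings and the defect theorem -/

variable {B D : Type*}

/-- A stream is parsable if it is an infinite concatenation of words `τ d`. -/
def Parsable (τ : D → List B) (w : Stream' B) : Prop :=
  ∃ W : Set (Stream' B), w ∈ W ∧ ∀ u ∈ W, ∃ d, ∃ v ∈ W, u = τ d ++ₛ v

theorem Parsable.exists_eq_append {τ : D → List B} {w : Stream' B} (h : Parsable τ w) :
    ∃ d v, Parsable τ v ∧ w = τ d ++ₛ v := by
  obtain ⟨W, hw, hW⟩ := h
  obtain ⟨d, v, hv, rfl⟩ := hW w hw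
  exact ⟨d, v, ⟨W, hv, hW⟩, rfl⟩

theorem Parsable.flatMap_append {τ : D → List B} {w : Stream' B} (h : Parsable τ w)
    (l : List D) : Parsable τ (l.flatMap τ ++ₛ w) := by
  refine ⟨{u | ∃ (l : List D) (v : Stream' B), Parsable τ v ∧ u = l.flatMap τ ++ₛ v},
    ⟨l, w, h, rfl⟩, ?_⟩
  rintro u ⟨l, v, hv, rfl⟩
  cases l with
  | nil =>
    obtain ⟨d, v', hv', rfl⟩ := hv.exists_eq_append
    exact ⟨d, v', ⟨[], v', hv', rfl⟩, rfl⟩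
  | cons d l =>
    exact ⟨d, l.flatMap τ ++ₛ v, ⟨l, v, hv, rfl⟩, by
      rw [List.flatMap_cons, Stream'.append_append_stream]⟩

/-- The invariant set consists of the unread rest of a block `β d` followed by a `τ`-parsable
stream; blocks are nonempty, so a next letter always exists. -/
theorem Parsable.of_factor {C : Type*} {τ : D → List B} {β : D → List C} {γ : C → List B}
    (hβ : ∀ d, β d ≠ []) (h : ∀ d, τ d = (β d).flatMap γ) {w : Stream' B}
    (hw : Parsable τ w) : Parsable γ w := by
  refine ⟨{u | ∃ (l : List C) (v : Stream' B), Parsable τ v ∧ u = l.flatMap γ ++ₛ v},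
    ⟨[], w, hw, rfl⟩, ?_⟩
  rintro u ⟨l, v, hv, rfl⟩
  obtain ⟨c, l', v', hv', e⟩ : ∃ c l' v', Parsable τ v' ∧
      l.flatMap γ ++ₛ v = (c :: l').flatMap γ ++ₛ v' := by
    cases l with
    | nil =>
      obtain ⟨d, v', hv', rfl⟩ := hv.exists_eq_append
      obtain ⟨c, l', e⟩ := List.exists_cons_of_ne_nil (hβ d)
      exact ⟨c, l', v', hv', by rw [h d, e]; rfl⟩
    | cons c l => exact ⟨c, l, v, hv, rfl⟩
  exact ⟨c, l'.flatMap γ ++ₛ v', ⟨l', v', hv', rfl⟩, by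
    rw [e, List.flatMap_cons, Stream'.append_append_stream]⟩

/-- Two letters are related if some stream has parsings starting with each of them. -/
def StartRel (τ : D → List B) (c d : D) : Prop :=
  ∃ v w, Parsable τ v ∧ Parsable τ w ∧ τ c ++ₛ v = τ d ++ₛ w

/-- Refining parsings from `τ` to `γ` thus induces a map between the sets of classes, which is how
class counts are compared. -/
theorem StartRel.head {C : Type*} {τ : D → List B} {β : D → List C} {γ : C → List B}
    (hβ : ∀ d, β d ≠ []) (h : ∀ d, τ d = (β d).flatMap γ) {c d : D} (hcd : StartRel τ c d) :
    StartRel γ ((β c).head (hβ c)) ((β d).head (hβ d)) := by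
  obtain ⟨v, w, hv, hw, e⟩ := hcd
  have key : ∀ x, ∀ u, Parsable τ u →
      Parsable γ ((β x).tail.flatMap γ ++ₛ u) ∧
      τ x ++ₛ u = γ ((β x).head (hβ x)) ++ₛ ((β x).tail.flatMap γ ++ₛ u) := by
    intro x u hu
    refine ⟨(hu.of_factor hβ h).flatMap_append _, ?_⟩
    rw [← Stream'.append_append_stream, ← List.flatMap_cons, List.cons_head_tail, ← h]
  exact ⟨_, _, (key c v hv).1, (key d w hw).1, by rw [← (key c v hv).2, ← (key d w hw).2, e]⟩

theorem append_stream_eq_append_stream {u v : List B} {s t : Stream' B}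
    (h : u ++ₛ s = v ++ₛ t) :
    (∃ r, v = u ++ r ∧ s = r ++ₛ t) ∨ ∃ r, u = v ++ r ∧ t = r ++ₛ s := by
  induction u generalizing v with
  | nil => exact Or.inl ⟨v, rfl, h⟩
  | cons a u ih =>
    cases v with
    | nil => exact Or.inr ⟨a :: u, rfl, h.symm⟩
    | cons b v =>
      rw [Stream'.cons_append_stream, Stream'.cons_append_stream] at h
      obtain ⟨rfl, h'⟩ := Stream'.cons_injective2 h
      rcases ih h' with ⟨r, rfl, hr⟩ | ⟨r, rfl, hr⟩
      · exact Or.inl ⟨r, rfl, hr⟩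
      · exact Or.inr ⟨r, rfl, hr⟩

/-- `τ` is a composition of nonerasing morphisms through an alphabet with `k` letters. -/
def FactorsThrough (τ : D → List B) (k : ℕ) : Prop :=
  ∃ (β : D → List (Fin k)) (γ : Fin k → List B),
    (∀ d, β d ≠ []) ∧ (∀ c, γ c ≠ []) ∧ ∀ d, τ d = (β d).flatMap γ

theorem FactorsThrough.of_factor {C : Type*} {τ : D → List B} {β : D → List C} {γ : C → List B}
    (hβ : ∀ d, β d ≠ []) (h : ∀ d, τ d = (β d).flatMap γ) {k : ℕ}
    (hk : FactorsThrough γ k) : FactorsThrough τ k := by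
  obtain ⟨β', γ', h1, h2, h3⟩ := hk
  refine ⟨fun d => (β d).flatMap β', γ', fun d => ?_, h2, fun d => ?_⟩
  · obtain ⟨c, l', e⟩ := List.exists_cons_of_ne_nil (hβ d)
    simp [e, h1]
  · rw [h, List.flatMap_assoc]
    congr 1
    exact funext h3

theorem factorsThrough_card [Finite D] (τ : D → List B) (hτ : ∀ d, τ d ≠ []) :
    FactorsThrough τ (Nat.card D) :=
  ⟨fun d => [Finite.equivFin D d], fun c => τ ((Finite.equivFin D).symm c),
    by simp, fun _ => hτ _, by simp⟩

/-- Defect theorem: a morphism factors through an alphabet with at most as many letters as there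
are classes of the equivalence relation generated by `StartRel`. -/
theorem exists_factorsThrough_card_quot [Finite D] (τ : D → List B) (hτ : ∀ d, τ d ≠ []) :
    ∃ k ≤ Nat.card (Quot (StartRel τ)), FactorsThrough τ k := by
  suffices H : ∀ n, ∀ {D : Type _} [Fintype D] (τ : D → List B), (∀ d, τ d ≠ []) →
      ∑ d, (τ d).length = n → ∃ k ≤ Nat.card (Quot (StartRel τ)), FactorsThrough τ k by
    cases nonempty_fintype D
    exact H _ τ hτ rfl
  clear! D
  intro n
  -- Induction on the total length of the words `τ d`, over all alphabets at once.
  induction n using Nat.strong_induction_on with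
  | _ n ih =>
  intro D _ τ hτ hn
  classical
  by_cases hR : ∀ c d, StartRel τ c d → c = d
  · refine ⟨_, ?_, factorsThrough_card τ hτ⟩
    refine Nat.card_le_card_of_injective (Quot.mk _) fun c d h => ?_
    have := congrArg (Quot.lift id hR) h
    exact this
  push Not at hR
  -- It suffices to factor through a shorter morphism without increasing the number of classes.
  have step : ∀ {C : Type _} [Fintype C] (β : D → List C) (γ : C → List B)
      (hβ : ∀ d, β d ≠ []), (∀ c, γ c ≠ []) → (∀ d, τ d = (β d).flatMap γ) →
      ∑ c, (γ c).length < n →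
      (∀ c, ∃ d, Quot.mk (StartRel γ) c = Quot.mk (StartRel γ) ((β d).head (hβ d))) →
      ∃ k ≤ Nat.card (Quot (StartRel τ)), FactorsThrough τ k := by
    intro C _ β γ hβ hγ h hlt hsurj
    obtain ⟨k, hk, hf⟩ := ih _ hlt γ hγ rfl
    refine ⟨k, hk.trans ?_, hf.of_factor hβ h⟩
    refine Nat.card_le_card_of_surjective
      (Quot.lift (fun d => Quot.mk (StartRel γ) ((β d).head (hβ d)))
        fun c d hcd => Quot.sound (hcd.head hβ h)) ?_
    rintro ⟨c⟩
    obtain ⟨d, hd⟩ := hsurj c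
    exact ⟨Quot.mk _ d, hd.symm⟩
  obtain ⟨c, d, v, w, hv, hw, hr, r, hd, e⟩ : ∃ c d v w, Parsable τ v ∧ Parsable τ w ∧ c ≠ d ∧
      ∃ r, τ d = τ c ++ r ∧ v = r ++ₛ w := by
    obtain ⟨c, d, ⟨v, w, hv, hw, e⟩, hne⟩ := hR
    rcases append_stream_eq_append_stream e with ⟨r, h1, h2⟩ | ⟨r, h1, h2⟩
    · exact ⟨c, d, v, w, hv, hw, hne, r, h1, h2⟩
    · exact ⟨d, c, w, v, hw, hv, hne.symm, r, h1, h2⟩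
  -- If `τ c = τ d`, the letter `d` is dropped. Otherwise `d` is rewritten as `c d`, and its new
  -- image is the shorter word `r`.
  by_cases hr0 : r = []
  · subst hr0
    refine step (C := {x // x ≠ d}) (fun x => if h : x = d then [⟨c, hr⟩] else [⟨x, h⟩])
      (fun x => τ x) (fun x => by split_ifs <;> simp) (fun x => hτ x) (fun x => ?_) ?_
      fun x => ⟨x, ?_⟩
    · split_ifs with h
      · subst h; simpa using hd
      · simp
    · rw [← hn, Fintype.sum_eq_add_sum_subtype_ne _ d]
      have := List.length_pos_of_ne_nil (hτ d)
      omega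
    · simp [x.2]
  · let γ := Function.update τ d r
    let β : D → List D := fun x => if x = d then [c, d] else [x]
    have hβ : ∀ x, β x ≠ [] := fun x => by dsimp only [β]; split_ifs <;> simp
    have hγ : ∀ x, γ x ≠ [] := fun x => by
      by_cases h : x = d
      · subst h; simpa [γ] using hr0
      · simpa [γ, h] using hτ x
    have hf : ∀ x, τ x = (β x).flatMap γ := fun x => by
      by_cases h : x = d
      · subst h; simp [γ, β, hr, hd]
      · simp [γ, β, h]
    refine step β γ hβ hγ hf ?_ fun x => ?_
    · rw [← hn]
      have hc := List.length_pos_of_ne_nil (hτ c)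
      refine Finset.sum_lt_sum (fun x _ => ?_) ⟨d, Finset.mem_univ _, ?_⟩
      · by_cases h : x = d
        · subst h; simp [γ, hd]
        · simp [γ, h]
      · simp only [γ, Function.update_self, hd, List.length_append]; omega
    · by_cases h : x = d
      · subst h
        -- The letter `d` heads no word `β x`, but `v = r w` also has a `τ`-parsing, starting with
        -- some `y`; so `d` is related to the head of `β y`.
        obtain ⟨y, v', hv', rfl⟩ := hv.exists_eq_append
        refine ⟨y, Quot.sound ⟨w, (β y).tail.flatMap γ ++ₛ v', hw.of_factor hβ hf,
          (hv'.of_factor hβ hf).flatMap_append _, ?_⟩⟩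
        rw [← Stream'.append_append_stream, ← List.flatMap_cons, List.cons_head_tail, ← hf, e]
        simp [γ]
      · exact ⟨x, by simp [β, h]⟩

/-! ### Elementary morphisms -/

/-- A morphism is elementary if it does not factor through a smaller alphabet. -/
def IsElementary (τ : D → List B) : Prop :=
  ∀ k, FactorsThrough τ k → Nat.card D ≤ k

theorem IsElementary.eq_of_startRel [Finite D] {τ : D → List B} (hE : IsElementary τ)
    (hτ : ∀ d, τ d ≠ []) {c d : D} (h : StartRel τ c d) : c = d := by
  by_contra hne
  obtain ⟨k, hk, hf⟩ := exists_factorsThrough_card_quot τ hτ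
  have h1 := hE k hf
  have : Function.Injective (Quot.mk (StartRel τ)) :=
    ((Nat.bijective_iff_surjective_and_card _).2 ⟨Quot.mk_surjective,
      le_antisymm (h1.trans hk) (Nat.card_le_card_of_surjective _ Quot.mk_surjective)⟩).1
  exact hne (this (Quot.sound h))

/-- For an elementary morphism, the letter parsed at a cut inside a word `τ a` is determined by the
position of the cut. -/
theorem IsElementary.eq_of_suffix [Finite D] {τ : D → List B} (hE : IsElementary τ)
    (hτ : ∀ d, τ d ≠ []) {a f g : D} {p u : List B} (ha : τ a = p ++ u) (hu : u ≠ [])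
    {v w v' w' : Stream' B} (hv : Parsable τ v) (hw : Parsable τ w) (hv' : Parsable τ v')
    (hw' : Parsable τ w') (e : u ++ₛ v = τ f ++ₛ w) (e' : u ++ₛ v' = τ g ++ₛ w') : f = g := by
  classical
  by_cases hp : p = []
  · subst hp
    rw [List.nil_append] at ha
    subst ha
    exact (hE.eq_of_startRel hτ ⟨v, w, hv, hw, e⟩).symm.trans
      (hE.eq_of_startRel hτ ⟨v', w', hv', hw', e'⟩)
  by_contra hne
  -- The letter `a` is split in two: `some a` has image `p` and `none` has image `u`.
  let γ : Option D → List B := fun x => x.elim u (Function.update τ a p)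
  let β : D → List (Option D) := fun x => if x = a then [some a, none] else [some x]
  have hβ : ∀ x, β x ≠ [] := fun x => by dsimp only [β]; split_ifs <;> simp
  have hγ : ∀ x, γ x ≠ [] := by
    rintro (_ | x)
    · exact hu
    · by_cases h : x = a
      · subst h; simpa [γ] using hp
      · simpa [γ, h] using hτ x
  have hf : ∀ x, τ x = (β x).flatMap γ := fun x => by
    by_cases h : x = a
    · subst h; simp [γ, β, ha]
    · simp [γ, β, h]
  have key : ∀ {f v w}, Parsable τ v → Parsable τ w → u ++ₛ v = τ f ++ₛ w →
      StartRel γ none (some f) := by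
    intro f v w hv hw e
    have hh : (β f).head (hβ f) = some f := by
      by_cases h : f = a
      · subst h; simp [β]
      · simp [β, h]
    refine ⟨v, (β f).tail.flatMap γ ++ₛ w, hv.of_factor hβ hf,
      (hw.of_factor hβ hf).flatMap_append _, ?_⟩
    rw [← hh, ← Stream'.append_append_stream, ← List.flatMap_cons, List.cons_head_tail, ← hf, ← e]
    rfl
  -- Since `none`, `f` and `g` share a class, at most `|D| - 1` of the `|D| + 1` letters are needed
  -- to meet all classes; the defect theorem for `γ` then contradicts elementarity of `τ`.
  have hs : Function.Surjective
      fun x : {x // x ≠ g} => Quot.mk (StartRel γ) (some x.1) := by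
    have h1 := Quot.sound (key hv hw e)
    have h2 := Quot.sound (key hv' hw' e')
    rintro ⟨_ | x⟩
    · exact ⟨⟨f, hne⟩, h1.symm⟩
    · by_cases h : x = g
      · subst h; exact ⟨⟨f, hne⟩, h1.symm.trans h2⟩
      · exact ⟨⟨x, h⟩, rfl⟩
  obtain ⟨k, hk, hk'⟩ := exists_factorsThrough_card_quot γ hγ
  have h1 := hE k (hk'.of_factor hβ hf)
  have h2 := Nat.card_le_card_of_surjective _ hs
  have h3 : Nat.card {x // x ≠ g} < Nat.card D := Finite.card_subtype_lt (x := g) (by simp)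
  omega

/-! ### Coordinates on a desubstituted bi-infinite sequence -/

/-- `x` is the concatenation of the words `τ (y l)`; the position `k` of `x` carries the letter
number `o k` of the word with index `M k`. -/
structure Desubst (τ : D → List B) (x : ℤ → B) (y : ℤ → D) (M : ℤ → ℤ) (o : ℤ → ℕ) : Prop where
  getElem? : ∀ k, (τ (y (M k)))[o k]? = some (x k)
  step : ∀ k, (o k + 1 < (τ (y (M k))).length ∧ M (k + 1) = M k ∧ o (k + 1) = o k + 1) ∨
    (o k + 1 = (τ (y (M k))).length ∧ M (k + 1) = M k + 1 ∧ o (k + 1) = 0)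

namespace Desubst

variable {τ : D → List B} {x : ℤ → B} {y : ℤ → D} {M : ℤ → ℤ} {o : ℤ → ℕ}

theorem lt (h : Desubst τ x y M o) (k : ℤ) : o k < (τ (y (M k))).length :=
  (List.getElem?_eq_some_iff.1 (h.getElem? k)).1

theorem translate (h : Desubst τ x y M o) (t : ℤ) :
    Desubst τ (fun k => x (k + t)) y (fun k => M (k + t)) (fun k => o (k + t)) :=
  ⟨fun k => h.getElem? (k + t), fun k => by
    have := h.step (k + t)
    rwa [show k + t + 1 = k + 1 + t by ring] at this⟩

theorem translate_index (h : Desubst τ x y M o) (j : ℤ) :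
    Desubst τ x (fun l => y (l + j)) (fun k => M k - j) o :=
  ⟨fun k => by simpa using h.getElem? k, fun k => by
    have := h.step k
    simp only [sub_add_cancel]
    omega⟩

theorem add_lt (h : Desubst τ x y M o) (k : ℤ) (t : ℕ) (ht : o k + t < (τ (y (M k))).length) :
    M (k + t) = M k ∧ o (k + t) = o k + t := by
  induction t with
  | zero => simp
  | succ t ih =>
    obtain ⟨h1, h2⟩ := ih (by omega)
    have := h.step (k + t)
    rw [h1, h2] at this
    push_cast
    rw [← add_assoc]
    omega

theorem add_eq (h : Desubst τ x y M o) (k : ℤ) (t : ℕ) (ht : o k + t = (τ (y (M k))).length) :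
    M (k + t) = M k + 1 ∧ o (k + t) = 0 := by
  have hk := h.lt k
  cases t with
  | zero => omega
  | succ t =>
    obtain ⟨h1, h2⟩ := h.add_lt k t (by omega)
    have := h.step (k + t)
    rw [h1, h2] at this
    push_cast
    rw [← add_assoc]
    omega

theorem sub_offset (h : Desubst τ x y M o) (k : ℤ) : M (k - o k) = M k ∧ o (k - o k) = 0 := by
  induction hn : o k generalizing k with
  | zero => simp [hn]
  | succ n ih =>
    have h1 := h.step (k - 1)
    rw [sub_add_cancel] at h1
    have h2 := ih (k - 1) (by omega)
    rw [show k - ((n + 1 : ℕ) : ℤ) = k - 1 - n by push_cast; ring]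
    omega

theorem exists_start (h : Desubst τ x y M o) (l : ℤ) : ∃ k, M k = l ∧ o k = 0 := by
  have up : ∀ k, o k = 0 → ∃ k', M k' = M k + 1 ∧ o k' = 0 := fun k hk =>
    ⟨_, h.add_eq k (τ (y (M k))).length (by omega)⟩
  have down : ∀ k, o k = 0 → ∃ k', M k' = M k - 1 ∧ o k' = 0 := fun k hk => by
    have h1 := h.step (k - 1)
    rw [sub_add_cancel] at h1
    have h2 := h.sub_offset (k - 1)
    exact ⟨_, by omega, h2.2⟩
  obtain ⟨k₀, hk₀⟩ : ∃ k, o k = 0 := ⟨_, (h.sub_offset 0).2⟩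
  suffices H : ∀ i : ℤ, ∃ k, M k = M k₀ + i ∧ o k = 0 by
    obtain ⟨k, hk⟩ := H (l - M k₀)
    exact ⟨k, by omega, hk.2⟩
  intro i
  induction i using Int.induction_on with
  | zero => exact ⟨k₀, by simp, hk₀⟩
  | succ i ih =>
    obtain ⟨k, h1, h2⟩ := ih
    obtain ⟨k', h3, h4⟩ := up k h2
    exact ⟨k', by omega, h4⟩
  | pred i ih =>
    obtain ⟨k, h1, h2⟩ := ih
    obtain ⟨k', h3, h4⟩ := down k h2
    exact ⟨k', by omega, h4⟩

theorem lex_lt (h : Desubst τ x y M o) (k : ℤ) (n : ℕ) :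
    M k < M (k + (n + 1 : ℕ)) ∨ (M k = M (k + (n + 1 : ℕ)) ∧ o k < o (k + (n + 1 : ℕ))) := by
  induction n with
  | zero =>
    have := h.step k
    simp only [zero_add, Nat.cast_one]
    omega
  | succ n ih =>
    have := h.step (k + (n + 1 : ℕ))
    rw [show k + ((n + 1 + 1 : ℕ) : ℤ) = k + (n + 1 : ℕ) + 1 by push_cast; ring]
    omega

theorem eq_of_eq (h : Desubst τ x y M o) {k l : ℤ} (hM : M k = M l) (ho : o k = o l) : k = l := by
  have key : ∀ k l, M k = M l → o k = o l → ¬ k < l := by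
    intro k l hM ho hlt
    have := h.lex_lt k (l - k - 1).toNat
    rw [show k + (((l - k - 1).toNat + 1 : ℕ) : ℤ) = l by omega] at this
    omega
  exact le_antisymm (not_lt.1 (key l k hM.symm ho.symm)) (not_lt.1 (key k l hM ho))

theorem index_mem (h : Desubst τ x y M o) (h0 : M 0 = 0) (k : ℤ) :
    M k ∈ Set.Icc (-(|k|)) |k| := by
  have key : ∀ k (n : ℕ), M k ≤ M (k + n) ∧ M (k + n) ≤ M k + n := by
    intro k n
    induction n with
    | zero => simp
    | succ n ih =>
      have := h.step (k + n)
      push_cast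
      rw [← add_assoc]
      omega
  rcases le_total 0 k with hk | hk
  · have := key 0 k.toNat
    rw [zero_add, Int.toNat_of_nonneg hk] at this
    rw [abs_of_nonneg hk, Set.mem_Icc]
    omega
  · have := key k (-k).toNat
    rw [Int.toNat_of_nonneg (by omega), add_neg_cancel] at this
    rw [abs_of_nonpos hk, Set.mem_Icc]
    omega

/-- The bridge between coordinates and finite words: it serves both to identify `σ.onSeq` and to
transfer a parsing of a finite word to `x`. -/
theorem window (h : Desubst τ x y M o) (u : List D) (k : ℤ) (hk : o k = 0)
    (hu : ∀ r : ℕ, r < u.length → u[r]? = some (y (M k + r))) :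
    (∀ t : ℕ, t < (u.flatMap τ).length → (u.flatMap τ)[t]? = some (x (k + t)) ∧
      M k ≤ M (k + t) ∧ M (k + t) < M k + u.length) ∧
    M (k + (u.flatMap τ).length) = M k + u.length ∧ o (k + (u.flatMap τ).length) = 0 := by
  induction u generalizing k with
  | nil => simp [hk]
  | cons d u ih =>
    have hd : d = y (M k) := by simpa using hu 0 (by simp)
    have hend := h.add_eq k (τ d).length (by rw [hk, hd, zero_add])
    obtain ⟨h1, h2⟩ := ih (k + (τ d).length) hend.2 fun r hr => by
      have := hu (r + 1) (by simpa using hr)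
      rw [List.getElem?_cons_succ] at this
      rw [this, hend.1]
      congr 2
      push_cast
      ring
    rw [hend.1] at h1 h2
    simp only [List.flatMap_cons, List.length_append, List.length_cons]
    refine ⟨fun t ht => ?_, ?_⟩
    · by_cases htd : t < (τ d).length
      · have h3 := h.add_lt k t (by rw [hk, ← hd]; omega)
        have h4 := h.getElem? (k + t)
        rw [h3.1, h3.2, hk, zero_add, ← hd] at h4
        rw [List.getElem?_append_left htd, h4, h3.1]
        exact ⟨rfl, by omega, by omega⟩
      · obtain ⟨h3, h4⟩ := h1 (t - (τ d).length) (by omega)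
        rw [show k + (τ d).length + ((t - (τ d).length : ℕ) : ℤ) = k + t by omega] at h3 h4
        rw [List.getElem?_append_right (by omega), h3]
        exact ⟨rfl, by omega, by omega⟩
    · push_cast
      rw [← add_assoc]
      exact ⟨by omega, h2.2⟩

end Desubst

/-! ### Construction of `τ(y)` and comparison with `onSeq` -/

theorem exists_orbit {S : Type*} {r : S → S → Prop} (h : ∀ s, ∃ s', r s s')
    (h' : ∀ s, ∃ s', r s' s) (s₀ : S) : ∃ f : ℤ → S, f 0 = s₀ ∧ ∀ k, r (f k) (f (k + 1)) := by
  choose F hF using h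
  choose G hG using h'
  refine ⟨fun k => match k with
    | Int.ofNat n => F^[n] s₀
    | Int.negSucc n => G^[n + 1] s₀, rfl, ?_⟩
  rintro (n | _ | n)
  · change r (F^[n] s₀) (F^[n + 1] s₀)
    rw [Function.iterate_succ_apply']
    exact hF _
  · exact hG s₀
  · change r (G^[n + 1 + 1] s₀) (G^[n + 1] s₀)
    rw [Function.iterate_succ_apply' _ (n + 1)]
    exact hG _

/-- Pairs (index, offset) have a successor and a predecessor; the positions of `τ(y)` form the orbit
of `(0, 0)`. -/
theorem exists_desubst (τ : D → List B) (hτ : ∀ d, τ d ≠ []) (y : ℤ → D) :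
    ∃ x M o, Desubst τ x y M o ∧ M 0 = 0 ∧ o 0 = 0 := by
  have hpos : ∀ d, 0 < (τ d).length := fun d => List.length_pos_of_ne_nil (hτ d)
  let S := {s : ℤ × ℕ // s.2 < (τ (y s.1)).length}
  obtain ⟨f, h0, hf⟩ := exists_orbit (S := S) (r := fun s s' =>
    (s.1.2 + 1 < (τ (y s.1.1)).length ∧ s'.1.1 = s.1.1 ∧ s'.1.2 = s.1.2 + 1) ∨
    (s.1.2 + 1 = (τ (y s.1.1)).length ∧ s'.1.1 = s.1.1 + 1 ∧ s'.1.2 = 0))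
    (fun ⟨⟨m, i⟩, hi⟩ => by
      rcases Nat.lt_or_ge (i + 1) (τ (y m)).length with h | h
      · exact ⟨⟨⟨m, i + 1⟩, h⟩, Or.inl ⟨h, rfl, rfl⟩⟩
      · exact ⟨⟨⟨m + 1, 0⟩, hpos _⟩, Or.inr ⟨le_antisymm hi h, rfl, rfl⟩⟩)
    (fun ⟨⟨m, i⟩, hi⟩ => by
      cases i with
      | zero =>
        have := hpos (y (m - 1))
        refine ⟨⟨⟨m - 1, (τ (y (m - 1))).length - 1⟩, by dsimp only; omega⟩, Or.inr ?_⟩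
        dsimp only
        omega
      | succ i => exact ⟨⟨⟨m, i⟩, Nat.lt_of_succ_lt hi⟩, Or.inl ⟨hi, rfl, rfl⟩⟩)
    ⟨⟨0, 0⟩, hpos _⟩
  exact ⟨fun k => (τ (y (f k).1.1))[(f k).1.2]'(f k).2, fun k => (f k).1.1, fun k => (f k).1.2,
    ⟨fun k => List.getElem?_eq_getElem _, hf⟩, by simp [h0], by simp [h0]⟩

theorem Desubst.eq_onSeq {A : Type*} {σ : Substitution A} {x y : ℤ → A} {M : ℤ → ℤ} {o : ℤ → ℕ}
    (h : Desubst σ.word x y M o) (hM : M 0 = 0) (ho : o 0 = 0) : x = σ.onSeq y := by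
  funext k
  rcases k with n | n
  · have hn := lt_length_flatMap_range (fun i : ℕ => σ.word (y (i : ℤ)))
      (fun _ => σ.word_ne_nil _) n
    have hw := (h.window ((List.range (n + 1)).map fun i : ℕ => y i) 0 ho
      (by intro r hr; simp at hr; simp [hM, hr])).1 n (by rwa [List.flatMap_map])
    have := hw.1
    rw [List.flatMap_map, List.getElem?_eq_getElem hn, Option.some_inj, zero_add] at this
    exact this.symm
  · have hn := lt_length_flatMap_range (fun i : ℕ => (σ.word (y (-(i : ℤ) - 1))).reverse)
      (fun _ => mt List.reverse_eq_nil_iff.mp (σ.word_ne_nil _)) n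
    let u := ((List.range (n + 1)).map fun i : ℕ => y (-(i : ℤ) - 1)).reverse
    have hu : u.length = n + 1 := by simp [u]
    have hrev : ((List.range (n + 1)).flatMap fun i : ℕ => (σ.word (y (-(i : ℤ) - 1))).reverse) =
        (u.flatMap σ.word).reverse := by
      rw [List.reverse_flatMap, List.reverse_reverse, List.flatMap_map]
      rfl
    obtain ⟨k, hk, hk0⟩ := h.exists_start (-(n + 1 : ℤ))
    obtain ⟨h1, h2, h3⟩ := h.window u k hk0 (by
      intro r hr
      rw [hu] at hr
      rw [List.getElem?_reverse (by simpa using hr), List.getElem?_map,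
        List.getElem?_range (by simp), Option.map_some, hk]
      congr 2
      simp only [List.length_map, List.length_range]
      omega)
    -- The block of the last `n + 1` images ends at coordinates `(0, 0)`, which only position `0`
    -- has.
    have hk' : k + (u.flatMap σ.word).length = 0 :=
      h.eq_of_eq (by rw [h2, hM, hk, hu]; push_cast; ring) (by rw [h3, ho])
    have hlen : n < (u.flatMap σ.word).length := by
      rw [hrev, List.length_reverse] at hn
      exact hn
    have h4 := (h1 ((u.flatMap σ.word).length - 1 - n) (by omega)).1
    rw [← List.getElem?_reverse hlen, ← hrev, List.getElem?_eq_getElem hn, Option.some_inj,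
      show k + (((u.flatMap σ.word).length - 1 - n : ℕ) : ℤ) = Int.negSucc n by omega] at h4
    exact h4.symm

theorem exists_desubst_onSeq {A : Type*} (σ : Substitution A) (y : ℤ → A) :
    ∃ M o, Desubst σ.word (σ.onSeq y) y M o ∧ M 0 = 0 ∧ o 0 = 0 := by
  obtain ⟨x, M, o, h, hM, ho⟩ := exists_desubst σ.word σ.word_ne_nil y
  exact ⟨M, o, h.eq_onSeq hM ho ▸ h, hM, ho⟩

theorem leftShift_iterate {A : Type*} (n : ℕ) (x : ℤ → A) (k : ℤ) :
    leftShift^[n] x k = x (k + n) := by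
  induction n generalizing x k with
  | zero => simp
  | succ n ih =>
    rw [Function.iterate_succ_apply, ih]
    change x (1 + (k + n)) = _
    congr 1
    push_cast
    ring

theorem eq_leftShift_iterate_onSeq_iff {A : Type*} (σ : Substitution A) (x y : ℤ → A) (i : ℕ) :
    (i < (σ.word (y 0)).length ∧ x = leftShift^[i] (σ.onSeq y)) ↔
      ∃ M o, Desubst σ.word x y M o ∧ M 0 = 0 ∧ o 0 = i := by
  constructor
  · rintro ⟨hi, rfl⟩
    obtain ⟨M, o, h, hM, ho⟩ := exists_desubst_onSeq σ y
    have hx : leftShift^[i] (σ.onSeq y) = fun k => σ.onSeq y (k + i) :=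
      funext fun k => leftShift_iterate i _ k
    have h1 := h.add_lt 0 i (by rw [hM, ho, zero_add]; exact hi)
    exact ⟨_, _, hx ▸ h.translate i, h1.1.trans hM, by rw [h1.2, ho, zero_add]⟩
  · rintro ⟨M, o, h, hM, rfl⟩
    have hlt := h.lt 0
    rw [hM] at hlt
    refine ⟨hlt, ?_⟩
    have h1 := h.sub_offset 0
    rw [hM, zero_sub] at h1
    have h2 := (h.translate (-(o 0 : ℤ))).eq_onSeq (by simpa using h1.1) (by simpa using h1.2)
    funext k
    rw [leftShift_iterate, ← h2]
    simp

/-! ### Compactness and existence of desubstitutions -/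

theorem exists_eventually_eq_of_finite {ι S : Type*} (U : Ultrafilter ι) {s : Set S}
    {g : ι → S} (hs : s.Finite) (hg : ∀ m, g m ∈ s) : ∃ c, ∀ᶠ m in U, g m = c := by
  obtain ⟨c, -, hc⟩ := (Ultrafilter.eventually_exists_mem_iff (f := U)
    (P := fun c m => g m = c) hs).1 (Filter.Eventually.of_forall fun m => ⟨g m, hg m, rfl⟩)
  exact ⟨c, hc⟩

/-- Each condition involves finitely many coordinates, so it passes to the coordinatewise limit. The
normalization `Ms m 0 = 0` keeps each `Ms m k` in a finite set. -/
theorem exists_desubst_of_eventually_eq [Finite D] {τ : D → List B} (U : Ultrafilter ℕ)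
    {xs : ℕ → ℤ → B} {ys : ℕ → ℤ → D} {Ms : ℕ → ℤ → ℤ} {os : ℕ → ℤ → ℕ}
    (h : ∀ m, Desubst τ (xs m) (ys m) (Ms m) (os m)) (h0 : ∀ m, Ms m 0 = 0) {x : ℤ → B}
    (hx : ∀ k, ∀ᶠ m in U, xs m k = x k) :
    ∃ y M o, Desubst τ x y M o ∧ M 0 = 0 ∧ (∀ l, ∀ᶠ m in U, ys m l = y l) ∧
      ∀ k, ∀ᶠ m in U, Ms m k = M k := by
  obtain ⟨K, hK⟩ := Finite.exists_le fun d => (τ d).length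
  have hy : ∀ l, ∃ c, ∀ᶠ m in U, ys m l = c := fun l =>
    exists_eventually_eq_of_finite U Set.finite_univ fun _ => trivial
  have hM : ∀ k, ∃ c, ∀ᶠ m in U, Ms m k = c := fun k =>
    exists_eventually_eq_of_finite U (Set.finite_Icc _ _) fun m => (h m).index_mem (h0 m) k
  have ho : ∀ k, ∃ c, ∀ᶠ m in U, os m k = c := fun k =>
    exists_eventually_eq_of_finite U (Set.finite_Iio K) fun m => ((h m).lt k).trans_le (hK _)
  choose y hy using hy
  choose M hM using hM
  choose o ho using ho
  refine ⟨y, M, o, ⟨fun k => ?_, fun k => ?_⟩, ?_, hy, hM⟩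
  · obtain ⟨m, h1, h2, h3, h4⟩ := ((hM k).and ((ho k).and ((hy (M k)).and (hx k)))).exists
    have := (h m).getElem? k
    rwa [h1, h2, h3, h4] at this
  · obtain ⟨m, h1, h2, h3, h4, h5⟩ :=
      ((hM k).and ((ho k).and ((hy (M k)).and ((hM (k + 1)).and (ho (k + 1)))))).exists
    have := (h m).step k
    rwa [h1, h2, h3, h4, h5] at this
  · obtain ⟨m, h1⟩ := (hM 0).exists
    rw [← h1, h0]

theorem getElem?_factor {A : Type*} (x : ℤ → A) (i j : ℤ) (t : ℕ) (ht : i + t ≤ j) :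
    (factor x i j)[t]? = some (x (i + t)) := by
  rw [factor, List.getElem?_map, List.getElem?_range (by omega), Option.map_some]

theorem length_factor {A : Type*} (x : ℤ → A) (i j : ℤ) :
    (factor x i j).length = (j + 1 - i).toNat := by
  simp [factor]

theorem isInfix_of_getElem? {A : Type*} {v w : List A} (s : ℕ)
    (h : ∀ t < w.length, v[s + t]? = w[t]?) : w <:+: v := by
  have : w = (v.drop s).take w.length := by
    refine List.ext_getElem? fun t => ?_
    rw [List.getElem?_take, List.getElem?_drop]
    split_ifs with ht
    · exact (h t ht).symm
    · exact List.getElem?_eq_none (not_lt.1 ht)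
  rw [this]
  exact (List.take_prefix _ _).isInfix.trans (List.drop_suffix _ _).isInfix

theorem factor_isInfix {A : Type*} (x : ℤ → A) {i j i' j' : ℤ} (hi : i' ≤ i) (hj : j ≤ j') :
    factor x i j <:+: factor x i' j' := by
  refine isInfix_of_getElem? (i - i').toNat fun t ht => ?_
  rw [length_factor] at ht
  rw [getElem?_factor _ _ _ _ (by omega), getElem?_factor _ _ _ _ (by omega)]
  congr 2
  omega

theorem exists_desubst_of_isInfix {τ : D → List B} (hτ : ∀ d, τ d ≠ []) {x : ℤ → B} {v : List D}
    {n : ℕ} (h : factor x (-n) n <:+: v.flatMap τ) :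
    ∃ x' y M o, ∃ j : ℤ, Desubst τ x' y M o ∧ M 0 = 0 ∧ ∀ k : ℤ, -n ≤ k → k ≤ n →
      x' k = x k ∧ 0 ≤ M k + j ∧ v[(M k + j).toNat]? = some (y (M k)) := by
  obtain ⟨p, q, hpq⟩ := h
  have hlen : p.length + (2 * n + 1) + q.length = (v.flatMap τ).length := by
    rw [← hpq, List.length_append, List.length_append, length_factor]
    omega
  obtain ⟨d₀, v', hv'⟩ : ∃ d v', v = d :: v' := List.exists_cons_of_ne_nil (by
    rintro rfl
    simp at hlen)
  -- Indices outside `v` are filled with its first letter `d₀`, an irrelevant choice.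
  obtain ⟨x', M, o, hD, hM, ho⟩ := exists_desubst τ hτ fun l => (v[l.toNat]?).getD d₀
  have hv : ∀ r : ℕ, r < v.length → v[r]? = some ((v[((r : ℤ)).toNat]?).getD d₀) := by
    intro r hr
    simp [hr]
  have hw := (hD.window v 0 ho (by simpa [hM] using hv)).1
  rw [hM] at hw
  -- The place of `x 0` in `v.flatMap τ`; position and index are recentred there.
  let T : ℤ := p.length + n
  refine ⟨_, _, _, _, M T, (hD.translate T).translate_index (M T), by simp, fun k h1 h2 => ?_⟩
  obtain ⟨h3, h4, h5⟩ := hw (k + T).toNat (by omega)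
  rw [show (0 : ℤ) + ((k + T).toNat : ℤ) = k + T by omega] at h3 h4 h5
  refine ⟨?_, by simpa using h4, ?_⟩
  · rw [← hpq, List.append_assoc, List.getElem?_append_right (by omega),
      List.getElem?_append_left (by rw [length_factor]; omega),
      getElem?_factor _ _ _ _ (by omega), Option.some_inj] at h3
    rw [← h3]
    congr 1
    omega
  · have := hv (M (k + T)).toNat (by omega)
    rw [Int.toNat_of_nonneg h4] at this
    simpa using this

theorem exists_desubst_of_forall_isInfix [Finite D] {τ : D → List B} (hτ : ∀ d, τ d ≠ [])
    {x : ℤ → B} {V : Set (List D)}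
    (h : ∀ n : ℕ, ∃ v ∈ V, factor x (-n) n <:+: v.flatMap τ) :
    ∃ y M o, Desubst τ x y M o ∧ M 0 = 0 ∧ ∀ n : ℕ, ∃ v ∈ V, factor y (-n) n <:+: v := by
  choose v hvV hv using h
  choose xs ys Ms os j hD h0 hs using fun n => exists_desubst_of_isInfix hτ (hv n)
  let U : Ultrafilter ℕ := Filter.hyperfilter ℕ
  have hU : ∀ n : ℕ, ∀ᶠ m in (U : Filter ℕ), n ≤ m := fun n =>
    Nat.hyperfilter_le_atTop (Filter.eventually_ge_atTop n)
  obtain ⟨y, M, o, hy, hM, hys, hMs⟩ := exists_desubst_of_eventually_eq U hD h0 (x := x)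
    fun k => (hU k.natAbs).mono fun m hm => (hs m k (by omega) (by omega)).1
  refine ⟨y, M, o, hy, hM, fun n => ?_⟩
  -- The word of index `l` starts at position `kk l`, so the letter `y l` is read inside `v m` once
  -- the window of `x` reaches `kk l`.
  choose kk hkk using hy.exists_start
  have hev : ∀ l ∈ Set.Icc (-n : ℤ) n, ∀ᶠ m in U, 0 ≤ l + j m ∧
      (v m)[(l + j m).toNat]? = some (y l) := by
    intro l _
    filter_upwards [hU (kk l).natAbs, hMs (kk l), hys l] with m h1 h2 h3
    have := (hs m (kk l) (by omega) (by omega)).2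
    rwa [h2, (hkk l).1, h3] at this
  obtain ⟨m, hm⟩ := ((Filter.eventually_all_finite (Set.finite_Icc _ _)).2 hev).exists
  refine ⟨v m, hvV m, isInfix_of_getElem? (-n + j m).toNat fun t ht => ?_⟩
  rw [length_factor] at ht
  rw [getElem?_factor _ _ _ _ (by omega)]
  have h0 := (hm (-n) ⟨le_rfl, by omega⟩).1
  rw [← (hm (-n + t) ⟨by omega, by omega⟩).2]
  congr 1
  omega

/-! ### Two parsings by an elementary morphism -/

/-- `x` is a concatenation of words `τ d`; the position `k` of `x` carries the letter number
`(P k).2` of a word `τ (P k).1`. -/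
structure IsParse (τ : D → List B) (x : ℤ → B) (P : ℤ → D × ℕ) : Prop where
  getElem? : ∀ k, (τ (P k).1)[(P k).2]? = some (x k)
  step : ∀ k, ((P k).2 + 1 < (τ (P k).1).length ∧ P (k + 1) = ((P k).1, (P k).2 + 1)) ∨
    ((P k).2 + 1 = (τ (P k).1).length ∧ (P (k + 1)).2 = 0)

/-- Forgetting absolute indices leaves finitely many states, as the pigeonhole argument needs. -/
theorem Desubst.isParse {τ : D → List B} {x : ℤ → B} {y : ℤ → D} {M : ℤ → ℤ} {o : ℤ → ℕ}
    (h : Desubst τ x y M o) : IsParse τ x fun k => (y (M k), o k) :=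
  ⟨h.getElem?, fun k => (h.step k).imp (fun h => ⟨h.1, by rw [h.2.1, h.2.2]⟩)
    fun h => ⟨h.1, h.2.2⟩⟩

/-- The stream of the letters of `x` from position `k` on. -/
def streamFrom (x : ℤ → B) (k : ℤ) : Stream' B := fun n => x (k + n)

namespace IsParse

variable {τ : D → List B} {x : ℤ → B} {P Q : ℤ → D × ℕ}

theorem lt (h : IsParse τ x P) (k : ℤ) : (P k).2 < (τ (P k).1).length :=
  (List.getElem?_eq_some_iff.1 (h.getElem? k)).1

theorem add_lt (h : IsParse τ x P) (k : ℤ) (t : ℕ) (ht : (P k).2 + t < (τ (P k).1).length) :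
    P (k + t) = ((P k).1, (P k).2 + t) := by
  induction t with
  | zero => simp
  | succ t ih =>
    have h1 := ih (by omega)
    have := h.step (k + t)
    rw [h1] at this
    push_cast
    rw [← add_assoc]
    rcases this with ⟨_, h2⟩ | ⟨h2, _⟩
    · rw [h2, add_assoc]
    · dsimp only at h2
      omega

theorem add_eq (h : IsParse τ x P) (k : ℤ) (t : ℕ) (ht : (P k).2 + t = (τ (P k).1).length) :
    (P (k + t)).2 = 0 := by
  have hk := h.lt k
  cases t with
  | zero => omega
  | succ t =>
    have h1 := h.add_lt k t (by omega)
    have := h.step (k + t)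
    rw [h1] at this
    push_cast
    rw [← add_assoc]
    rcases this with ⟨h2, _⟩ | ⟨_, h2⟩
    · dsimp only at h2
      omega
    · exact h2

theorem streamFrom_eq (h : IsParse τ x P) (k : ℤ) :
    streamFrom x k = (τ (P k).1).drop (P k).2 ++ₛ
      streamFrom x (k + ((τ (P k).1).length - (P k).2 : ℕ)) := by
  set r := (τ (P k).1).length - (P k).2 with hr
  have h1 : (streamFrom x k).take r = (τ (P k).1).drop (P k).2 := by
    refine List.ext_getElem? fun t => ?_
    by_cases ht : t < r
    · rw [Stream'.getElem?_take ht, List.getElem?_drop]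
      have h2 := h.getElem? (k + t)
      rw [h.add_lt k t (by omega)] at h2
      exact h2.symm
    · rw [List.getElem?_eq_none (by simpa using ht),
        List.getElem?_eq_none (by rw [List.length_drop]; omega)]
  have h2 : (streamFrom x k).drop r = streamFrom x (k + r) := by
    funext n
    change x (k + ((n + r : ℕ) : ℤ)) = x (k + r + n)
    congr 1
    push_cast
    ring
  rw [← h1, ← h2, Stream'.append_take_drop]

theorem parsable (h : IsParse τ x P) {k : ℤ} (hk : (P k).2 = 0) :
    Parsable τ (streamFrom x k) := by
  refine ⟨{w | ∃ k, (P k).2 = 0 ∧ w = streamFrom x k}, ⟨k, hk, rfl⟩, ?_⟩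
  rintro _ ⟨l, hl, rfl⟩
  have h1 := h.streamFrom_eq l
  rw [hl, List.drop_zero] at h1
  exact ⟨_, _, ⟨_, h.add_eq l ((τ (P l).1).length - 0) (by omega), rfl⟩, h1⟩

theorem exists_parsable (h : IsParse τ x P) (k : ℤ) :
    ∃ w, Parsable τ w ∧ streamFrom x k = (τ (P k).1).drop (P k).2 ++ₛ w := by
  have := h.lt k
  exact ⟨_, h.parsable (h.add_eq k _ (by omega)), h.streamFrom_eq k⟩

theorem exists_parsable_of_cut (h : IsParse τ x P) {k : ℤ} (hk : (P k).2 = 0) :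
    ∃ w, Parsable τ w ∧ streamFrom x k = τ (P k).1 ++ₛ w := by
  simpa [hk] using h.exists_parsable k

theorem eq_of_common_cut [Finite D] (hE : IsElementary τ) (hτ : ∀ d, τ d ≠ [])
    (hP : IsParse τ x P) (hQ : IsParse τ x Q) {k : ℤ} (hk : (P k).2 = 0) (hk' : (Q k).2 = 0) :
    P k = Q k := by
  obtain ⟨v, hv, e⟩ := hP.exists_parsable_of_cut hk
  obtain ⟨w, hw, e'⟩ := hQ.exists_parsable_of_cut hk'
  exact Prod.ext (hE.eq_of_startRel hτ ⟨v, w, hv, hw, e ▸ e'⟩) (hk.trans hk'.symm)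

/-- The state of `P` fixes the rest of the current `P`-word, and `eq_of_suffix` applies to that
rest. -/
theorem eq_of_cut [Finite D] (hE : IsElementary τ) (hτ : ∀ d, τ d ≠ [])
    (hP : IsParse τ x P) (hQ : IsParse τ x Q) {k l : ℤ} (h : P k = P l) (hk : (Q k).2 = 0)
    (hl : (Q l).2 = 0) : Q k = Q l := by
  obtain ⟨v, hv, e⟩ := hP.exists_parsable k
  obtain ⟨w, hw, f⟩ := hQ.exists_parsable_of_cut hk
  obtain ⟨v', hv', e'⟩ := hP.exists_parsable l
  obtain ⟨w', hw', f'⟩ := hQ.exists_parsable_of_cut hl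
  rw [← h] at e'
  refine Prod.ext (hE.eq_of_suffix hτ (List.take_append_drop _ _).symm ?_ hv hw hv' hw'
    (e.symm.trans f) (e'.symm.trans f')) (hk.trans hl.symm)
  rw [Ne, List.drop_eq_nil_iff]
  exact not_le.2 (hP.lt k)

theorem eq_add_of_eq [Finite D] (hE : IsElementary τ) (hτ : ∀ d, τ d ≠ [])
    (hP : IsParse τ x P) (hQ : IsParse τ x Q) {k : ℤ} (h : P k = Q k) (n : ℕ) :
    P (k + n) = Q (k + n) := by
  induction n with
  | zero => simpa using h
  | succ n ih =>
    push_cast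
    rw [← add_assoc]
    have h1 := hP.step (k + n)
    have h2 := hQ.step (k + n)
    rw [ih] at h1
    rcases h1 with ⟨h1, h3⟩ | ⟨h1, h3⟩ <;> rcases h2 with ⟨h2, h4⟩ | ⟨h2, h4⟩
    · rw [h3, h4]
    · omega
    · omega
    · exact eq_of_common_cut hE hτ hP hQ h3 h4

theorem cut_succ_iff (h : IsParse τ x P) (k : ℤ) :
    (P (k + 1)).2 = 0 ↔ (P k).2 + 1 = (τ (P k).1).length := by
  rcases h.step k with ⟨h1, h2⟩ | ⟨h1, h2⟩
  · rw [h2]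
    dsimp only
    omega
  · exact ⟨fun _ => h1, fun _ => h2⟩

/-- Away from common cuts the pair of states is deterministic: if one parsing cuts, the other is
inside a word and dictates the next letter. -/
theorem succ_eq_of_eq [Finite D] (hE : IsElementary τ) (hτ : ∀ d, τ d ≠ [])
    (hP : IsParse τ x P) (hQ : IsParse τ x Q) {k l : ℤ} (h : P k = P l) (h' : Q k = Q l)
    (hk : ¬((P (k + 1)).2 = 0 ∧ (Q (k + 1)).2 = 0)) :
    ¬((P (l + 1)).2 = 0 ∧ (Q (l + 1)).2 = 0) ∧ P (k + 1) = P (l + 1) ∧ Q (k + 1) = Q (l + 1) := by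
  refine ⟨by rwa [hP.cut_succ_iff, hQ.cut_succ_iff, ← h, ← h', ← hP.cut_succ_iff,
    ← hQ.cut_succ_iff], ?_⟩
  have cont : ∀ {P : ℤ → D × ℕ}, IsParse τ x P → P k = P l → (P (k + 1)).2 ≠ 0 →
      P (k + 1) = P (l + 1) := by
    intro P hP h h0
    rcases hP.step k with ⟨h1, h2⟩ | ⟨h1, h2⟩
    · rcases hP.step l with ⟨h3, h4⟩ | ⟨h3, h4⟩
      · rw [h2, h4, h]
      · rw [← h] at h3
        omega
    · exact absurd h2 h0
  have cut : ∀ {P : ℤ → D × ℕ}, IsParse τ x P → P k = P l → (P (k + 1)).2 = 0 →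
      (P (l + 1)).2 = 0 := by
    intro P hP h h0
    rwa [hP.cut_succ_iff, ← h, ← hP.cut_succ_iff]
  by_cases hp : (P (k + 1)).2 = 0
  · have hq := cont hQ h' fun hq => hk ⟨hp, hq⟩
    exact ⟨eq_of_cut hE hτ hQ hP hq hp (cut hP h hp), hq⟩
  · have hp' := cont hP h hp
    refine ⟨hp', ?_⟩
    by_cases hq : (Q (k + 1)).2 = 0
    · exact eq_of_cut hE hτ hP hQ hp' hq (cut hQ h' hq)
    · exact cont hQ h' hq

theorem finite_range [Finite D] (h : IsParse τ x P) : (Set.range P).Finite := by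
  obtain ⟨K, hK⟩ := Finite.exists_le fun d => (τ d).length
  refine ((Set.finite_univ (α := D)).prod (Set.finite_Iio K)).subset ?_
  rintro _ ⟨k, rfl⟩
  exact ⟨trivial, (h.lt k).trans_le (hK _)⟩

/-- A sequence with two parsings by an elementary morphism is periodic. -/
theorem periodic_of_ne [Finite D] (hE : IsElementary τ) (hτ : ∀ d, τ d ≠ [])
    (hP : IsParse τ x P) (hQ : IsParse τ x Q) (hne : P ≠ Q) :
    ∃ p : ℕ, 0 < p ∧ ∀ k, x (k + p) = x k := by
  obtain ⟨k₀, hk₀⟩ := Function.ne_iff.1 hne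
  let U : ℤ → Prop := fun k => ∀ l ≤ k, ¬((P l).2 = 0 ∧ (Q l).2 = 0)
  -- A common cut at `l ≤ k₀` would make the parsings agree from `l` on, in particular at `k₀`.
  have hU : U k₀ := fun l hl hc => hk₀ (by
    have := eq_add_of_eq hE hτ hP hQ (eq_of_common_cut hE hτ hP hQ hc.1 hc.2) (k₀ - l).toNat
    rwa [show l + ((k₀ - l).toNat : ℤ) = k₀ by omega] at this)
  have hprop : ∀ i j : ℤ, i < j → U j → P i = P j → Q i = Q j → ∀ n : ℕ,
      U (j + n) ∧ P (i + n) = P (j + n) ∧ Q (i + n) = Q (j + n) := by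
    intro i j hij hj h h' n
    induction n with
    | zero => simpa using ⟨hj, h, h'⟩
    | succ n ih =>
      obtain ⟨h1, h2, h3⟩ := ih
      push_cast
      rw [← add_assoc, ← add_assoc]
      have := succ_eq_of_eq hE hτ hP hQ h2 h3 (h1 _ (by omega))
      refine ⟨fun l hl => ?_, this.2⟩
      rcases hl.lt_or_eq with hl | rfl
      · exact h1 l (by omega)
      · exact this.1
  let s : ℤ → (D × ℕ) × (D × ℕ) := fun k => (P k, Q k)
  have hfin : (Set.range P ×ˢ Set.range Q).Finite := hP.finite_range.prod hQ.finite_range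
  let F := hfin.toFinset
  -- Pigeonhole on `k, k - 1, …, k - F.card` gives a period at most `F.card` to the right of `k`. It
  -- depends on `k`; the factorial is a common multiple.
  have hper : ∀ k ≤ k₀, ∀ n : ℕ, P (k + n + F.card.factorial) = P (k + n) := by
    intro k hk n
    obtain ⟨a, ha, b, hb, hab, e⟩ := Finset.exists_ne_map_eq_of_card_lt_of_maps_to
      (s := Finset.range (F.card + 1)) (t := F) (f := fun a : ℕ => s (k - a)) (by simp)
      (fun a _ => by simp [F, s])
    obtain ⟨a, b, hab, ha, e⟩ : ∃ a b : ℕ, b < a ∧ a ≤ F.card ∧ s (k - a) = s (k - b) := by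
      simp only [Finset.mem_range] at ha hb
      rcases lt_or_gt_of_ne hab with h | h
      · exact ⟨b, a, h, by omega, e.symm⟩
      · exact ⟨a, b, h, by omega, e⟩
    have h1 := hprop (k - a) (k - b) (by omega) (fun l hl => hU l (by omega))
      (congrArg Prod.fst e) (congrArg Prod.snd e)
    have h2 : ∀ m : ℤ, k ≤ m → P (m + (a - b : ℕ)) = P m := by
      intro m hm
      have := (h1 (m - k + a).toNat).2.1
      rw [show k - a + ((m - k + a).toNat : ℤ) = m by omega,
        show k - b + ((m - k + a).toNat : ℤ) = m + (a - b : ℕ) by omega] at this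
      exact this.symm
    have h3 : ∀ c : ℕ, P (k + n + ((a - b) * c : ℕ)) = P (k + n) := by
      intro c
      induction c with
      | zero => simp
      | succ c ih =>
        rw [← ih, ← h2 (k + n + ((a - b) * c : ℕ)) (by omega)]
        congr 1
        push_cast
        ring
    obtain ⟨c, hc⟩ := Nat.dvd_factorial (Nat.sub_pos_of_lt hab) (show a - b ≤ F.card by omega)
    rw [hc]
    exact h3 c
  refine ⟨F.card.factorial, Nat.factorial_pos _, fun k => ?_⟩
  have h1 := hper (min k k₀) (min_le_right _ _) (k - min k k₀).toNat
  rw [show min k k₀ + ((k - min k k₀).toNat : ℤ) = k by omega] at h1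
  have h2 := hP.getElem? (k + F.card.factorial)
  rw [h1, hP.getElem? k] at h2
  exact (Option.some_inj.1 h2).symm

end IsParse

/-! ### Composition of parsings -/

theorem length_flatMap_take_succ {B D : Type*} (τ : D → List B) {u : List D} {q : ℕ} {d : D}
    (h : u[q]? = some d) :
    ((u.take (q + 1)).flatMap τ).length = ((u.take q).flatMap τ).length + (τ d).length := by
  rw [List.take_add_one, h]
  simp

theorem length_flatMap_take_mono {B D : Type*} (τ : D → List B) (u : List D) {q r : ℕ}
    (h : q ≤ r) : ((u.take q).flatMap τ).length ≤ ((u.take r).flatMap τ).length := by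
  obtain ⟨v, hv⟩ := List.take_prefix_take_left (l := u) h
  rw [← hv]
  simp

/-- A position in `τ (u)` determines the letter of `u` and the offset in its image. -/
theorem eq_of_length_flatMap_take_add_eq {B D : Type*} (τ : D → List B) {u : List D}
    {q q' i i' : ℕ} {d d' : D} (hq : u[q]? = some d) (hq' : u[q']? = some d')
    (hi : i < (τ d).length) (hi' : i' < (τ d').length)
    (h : ((u.take q).flatMap τ).length + i = ((u.take q').flatMap τ).length + i') :
    d = d' ∧ i = i' := by
  have h1 := length_flatMap_take_succ τ hq
  have h2 := length_flatMap_take_succ τ hq'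
  rcases lt_trichotomy q q' with hlt | rfl | hlt
  · have := length_flatMap_take_mono τ u (Nat.succ_le_of_lt hlt)
    rw [Nat.succ_eq_add_one] at this
    omega
  · rw [hq, Option.some_inj] at hq'
    exact ⟨hq', by omega⟩
  · have := length_flatMap_take_mono τ u (Nat.succ_le_of_lt hlt)
    rw [Nat.succ_eq_add_one] at this
    omega

theorem Desubst.comp {B C D : Type*} {τ : D → List B} {α : C → List D} (hτ : ∀ d, τ d ≠ [])
    {x : ℤ → B} {y : ℤ → D} {M : ℤ → ℤ} {o : ℤ → ℕ} {Q : ℤ → C × ℕ} (h : Desubst τ x y M o)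
    (hQ : IsParse α y Q) :
    IsParse (fun c => (α c).flatMap τ) x fun k =>
      ((Q (M k)).1, (((α (Q (M k)).1).take (Q (M k)).2).flatMap τ).length + o k) := by
  have hlen : ∀ c, (((α c).take (α c).length).flatMap τ).length = ((α c).flatMap τ).length :=
    fun c => by rw [List.take_length]
  refine ⟨fun k => ?_, fun k => ?_⟩
  · dsimp only
    have h1 := h.getElem? k
    have h2 := h.lt k
    obtain ⟨h3, h4⟩ := List.getElem?_eq_some_iff.1 (hQ.getElem? (M k))
    generalize α (Q (M k)).1 = u at *
    generalize (Q (M k)).2 = q at *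
    have hu : u.flatMap τ =
        (u.take q).flatMap τ ++ (τ (y (M k)) ++ (u.drop (q + 1)).flatMap τ) := by
      rw [← h4, ← List.flatMap_cons, ← List.drop_eq_getElem_cons h3, ← List.flatMap_append,
        List.take_append_drop]
    rw [hu, List.getElem?_append_right (Nat.le_add_right _ _), Nat.add_sub_cancel_left,
      List.getElem?_append_left h2]
    exact h1
  · dsimp only
    have h1 := length_flatMap_take_succ τ (hQ.getElem? (M k))
    have h2 := hlen (Q (M k)).1
    have h3 := length_flatMap_take_mono τ (α (Q (M k)).1) (Nat.succ_le_of_lt (hQ.lt (M k)))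
    rw [Nat.succ_eq_add_one] at h3
    rcases h.step k with ⟨h4, h5, h6⟩ | ⟨h4, h5, h6⟩
    · left
      refine ⟨by omega, ?_⟩
      rw [h5, h6, add_assoc]
    · rcases hQ.step (M k) with ⟨h7, h8⟩ | ⟨h7, h8⟩
      · left
        have h9 := hQ.getElem? (M k + 1)
        rw [h8] at h9
        dsimp only at h9
        have h10 := length_flatMap_take_succ τ h9
        have h11 := length_flatMap_take_mono τ (α (Q (M k)).1) (Nat.succ_le_of_lt h7)
        have h12 := List.length_pos_of_ne_nil (hτ (y (M k + 1)))
        rw [Nat.succ_eq_add_one] at h11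
        refine ⟨by omega, ?_⟩
        rw [h5, h6, h8]
        refine Prod.ext rfl ?_
        dsimp only
        omega
      · right
        rw [h7] at h1
        refine ⟨by omega, ?_⟩
        rw [h5, h6, h8]
        simp

/-- The increments of `M` can be read off the letters and offsets, so `M = M'`; and `M` takes every
value. -/
theorem Desubst.eq_of_parse_eq {B D : Type*} {τ : D → List B} {x : ℤ → B} {y y' : ℤ → D}
    {M M' : ℤ → ℤ} {o o' : ℤ → ℕ} (h : Desubst τ x y M o) (h' : Desubst τ x y' M' o')
    (hM : M 0 = M' 0) (hy : ∀ k, y (M k) = y' (M' k)) (ho : ∀ k, o k = o' k) : y = y' := by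
  have hstep : ∀ k, M (k + 1) - M k = M' (k + 1) - M' k := by
    intro k
    have h1 := h.step k
    have h2 := h'.step k
    rw [← hy, ← ho, ← ho] at h2
    omega
  have hMM : ∀ k, M k = M' k := by
    intro k
    induction k using Int.induction_on with
    | zero => exact hM
    | succ i ih =>
      have := hstep i
      omega
    | pred i ih =>
      have := hstep (-i - 1)
      rw [sub_add_cancel] at this
      omega
  funext l
  obtain ⟨k, rfl, -⟩ := h.exists_start l
  rw [hy, hMM]

/-! ### The subshift `X_σ` and recognizability -/

variable {A : Type*} (σ : Substitution A)

theorem onWord_iterate_eq_flatMap (n : ℕ) (w : List A) :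
    σ.onWord^[n] w = w.flatMap fun a => σ.onWord^[n] [a] := by
  have hnil : ∀ n, σ.onWord^[n] [] = [] := by
    intro n
    induction n with
    | zero => rfl
    | succ n ih => rw [Function.iterate_succ_apply', ih]; rfl
  have happ : ∀ u v, σ.onWord^[n] (u ++ v) = σ.onWord^[n] u ++ σ.onWord^[n] v := by
    intro u v
    induction n with
    | zero => rfl
    | succ n ih =>
      rw [Function.iterate_succ_apply', Function.iterate_succ_apply',
        Function.iterate_succ_apply', ih]
      exact List.flatMap_append
  induction w with
  | nil => exact hnil n
  | cons a w ih => rw [List.flatMap_cons, ← ih, ← happ, List.singleton_append]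

variable {σ}

theorem exists_factor_isInfix_iterate [Finite A] {x : ℤ → A} (hx : x ∈ σ.subshift) (N n : ℕ) :
    ∃ a m, N ≤ m ∧ factor x (-n) n <:+: σ.onWord^[m] [a] := by
  -- `K` bounds the lengths of all `σᵐ(a)` with `m < N`; a longer factor forces `m ≥ N`.
  obtain ⟨K, hK⟩ := Finite.exists_le fun p : Fin N × A => (σ.onWord^[p.1] [p.2]).length
  obtain ⟨a, m, -, h⟩ := hx (max n K)
  refine ⟨a, m, ?_, (factor_isInfix x (by omega) (by omega)).trans h⟩
  by_contra hm
  have h1 := hK (⟨m, not_le.1 hm⟩, a)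
  have h2 := h.length_le
  rw [length_factor] at h2
  dsimp only at h1
  omega

theorem exists_desubst_subshift [Finite A] {x : ℤ → A} (hx : x ∈ σ.subshift) :
    ∃ y ∈ σ.subshift, ∃ M o, Desubst σ.word x y M o ∧ M 0 = 0 := by
  obtain ⟨y, M, o, h, hM, hy⟩ := exists_desubst_of_forall_isInfix (V := σ.language)
    σ.word_ne_nil (x := x) fun n => by
      -- The exponent is at least `2` so that one application of `σ` can be removed while staying in
      -- `L(σ)`.
      obtain ⟨a, m, hm, h⟩ := exists_factor_isInfix_iterate hx 2 n
      obtain ⟨m, rfl⟩ := Nat.exists_eq_add_of_le' hm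
      refine ⟨σ.onWord^[m + 1] [a], ⟨a, m + 1, by omega, List.infix_rfl⟩, ?_⟩
      rwa [Function.iterate_succ_apply'] at h
  refine ⟨y, fun n => ?_, M, o, h, hM⟩
  obtain ⟨v, ⟨a, m, hm, hv⟩, h⟩ := hy n
  exact ⟨a, m, hm, h.trans hv⟩

/-- Long factors of `x` lie in `σⁿ(σᵐ(a)) = α(β(σᵐ(a)))`. -/
theorem exists_isParse [Finite A] {C : Type*} [Finite C] {n : ℕ} {β : A → List C}
    {α : C → List A} (hα : ∀ c, α c ≠ []) (h : ∀ a, σ.onWord^[n] [a] = (β a).flatMap α)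
    {x : ℤ → A} (hx : x ∈ σ.subshift) : ∃ Q, IsParse α x Q := by
  obtain ⟨y, M, o, h, -, -⟩ := exists_desubst_of_forall_isInfix (V := Set.univ) hα (x := x)
    fun l => by
      obtain ⟨a, m, hm, hl⟩ := exists_factor_isInfix_iterate hx n l
      obtain ⟨m, rfl⟩ := Nat.exists_eq_add_of_le hm
      refine ⟨(σ.onWord^[m] [a]).flatMap β, trivial, ?_⟩
      rw [Function.iterate_add_apply, onWord_iterate_eq_flatMap] at hl
      rw [List.flatMap_assoc]
      simpa only [h] using hl
  exact ⟨_, h.isParse⟩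

variable (σ) in
/-- Some power of `σ` factors through an alphabet so small that continuing with `σ` gives an
elementary morphism. -/
theorem exists_isElementary [Finite A] :
    ∃ (k n : ℕ) (β : A → List (Fin k)) (α : Fin k → List A), (∀ c, α c ≠ []) ∧
      (∀ a, σ.onWord^[n] [a] = (β a).flatMap α) ∧
      IsElementary fun c => (α c).flatMap σ.word := by
  classical
  have hex : ∃ (k n : ℕ) (β : A → List (Fin k)) (α : Fin k → List A), (∀ c, α c ≠ []) ∧
      ∀ a, σ.onWord^[n] [a] = (β a).flatMap α :=
    ⟨Nat.card A, 0, fun a => [Finite.equivFin A a], fun c => [(Finite.equivFin A).symm c],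
      by simp, by simp⟩
  obtain ⟨n, β, α, hα, h⟩ := Nat.find_spec hex
  refine ⟨_, n, β, α, hα, h, fun j hj => ?_⟩
  obtain ⟨δ, γ, -, hγ, hf⟩ := hj
  rw [Nat.card_fin]
  -- If `σ ∘ α` factors through `j` letters, so does `σⁿ⁺¹ = σ ∘ α ∘ β`; minimality gives the bound.
  refine Nat.find_min' hex ⟨n + 1, fun a => (β a).flatMap δ, γ, hγ, fun a => ?_⟩
  rw [Function.iterate_succ_apply', h, onWord, List.flatMap_assoc, List.flatMap_assoc]
  simp only [hf]

theorem Desubst.eq_of_isAperiodic [Finite A] (hσ : σ.IsAperiodic) {x y y' : ℤ → A}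
    {M M' : ℤ → ℤ} {o o' : ℤ → ℕ} (hx : x ∈ σ.subshift) (hy : y ∈ σ.subshift)
    (hy' : y' ∈ σ.subshift) (h : Desubst σ.word x y M o) (h' : Desubst σ.word x y' M' o')
    (hM : M 0 = M' 0) : y = y' ∧ o 0 = o' 0 := by
  obtain ⟨k, n, β, α, hα, hf, hE⟩ := exists_isElementary σ
  obtain ⟨Q, hQ⟩ := exists_isParse hα hf hy
  obtain ⟨Q', hQ'⟩ := exists_isParse hα hf hy'
  have hne : ∀ c, (α c).flatMap σ.word ≠ [] := fun c => by
    obtain ⟨a, l, e⟩ := List.exists_cons_of_ne_nil (hα c)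
    simp [e, σ.word_ne_nil]
  have heq := h.comp σ.word_ne_nil hQ
  have heq' := h'.comp σ.word_ne_nil hQ'
  by_cases hPQ : (fun k => ((Q (M k)).1,
      (((α (Q (M k)).1).take (Q (M k)).2).flatMap σ.word).length + o k)) =
      fun k => ((Q' (M' k)).1,
      (((α (Q' (M' k)).1).take (Q' (M' k)).2).flatMap σ.word).length + o' k)
  -- Equal composite states mean the same `c` and the same place in `σ(α c)`, hence the same letter
  -- of `α c` and the same offset.
  · have key : ∀ k, y (M k) = y' (M' k) ∧ o k = o' k := by
      intro k
      have h1 := Prod.ext_iff.1 (congrFun hPQ k)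
      have h2 := hQ.getElem? (M k)
      have h3 := hQ'.getElem? (M' k)
      dsimp only at h1
      obtain ⟨h1, h4⟩ := h1
      rw [← h1] at h3 h4
      exact eq_of_length_flatMap_take_add_eq σ.word h2 h3 (h.lt k) (h'.lt k) h4
    exact ⟨h.eq_of_parse_eq h' hM (fun k => (key k).1) fun k => (key k).2, (key 0).2⟩
  · obtain ⟨p, hp, hper⟩ := heq.periodic_of_ne hE hne heq' hPQ
    refine absurd ⟨p, hp, ?_⟩ (hσ x hx)
    funext k
    rw [leftShift_iterate, hper]

end Substitution

theorem mainTheorem3 {A : Type*} [Finite A] (σ : Substitution A) (hσ : σ.IsAperiodic) :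
    σ.IsRecognizable := by
  intro x hx
  obtain ⟨y, hy, M, o, h, hM⟩ := Substitution.exists_desubst_subshift hx
  refine ⟨(y, o 0), ⟨hy, (Substitution.eq_leftShift_iterate_onSeq_iff σ x y (o 0)).2
    ⟨M, o, h, hM, rfl⟩⟩, ?_⟩
  rintro ⟨y', i⟩ ⟨hy', hi⟩
  obtain ⟨M', o', h', hM', rfl⟩ := (Substitution.eq_leftShift_iterate_onSeq_iff σ x y' i).1 hi
  obtain ⟨h1, h2⟩ := h'.eq_of_isAperiodic hσ hx hy' hy h (hM'.trans hM.symm)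
  exact Prod.ext h1 h2
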